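/- Let $K$ be an algebraically closed field of arbitrary characteristic and let $1\le d<n$. Let $I_{d,n}$ be the set of $d$-tuples $i=(i_1<\dots<i_d)$ with entries in $\{1,\dots,n\}$, partially ordered by $i\ge j\iff i_t\ge j_t$ for all $t$. Let $G_{d,n}$ be the Grassmannian of $d$-dimensional subspaces of $K^n$, embedded in $\mathbb P(\wedge^d K^n)$ by the Plücker embedding $U\mapsto[a_1\wedge\dots\wedge a_d]$ ($a_1,\dots,a_d$ a basis of $U$), and let $p_i$ ($i\in I_{d,n}$) be the Plücker coordinates, i.e. the projective coordinates on $\mathbb P(\wedge^d K^n)$ with respect to the basis $e_{i_1}\wedge\dots\wedge e_{i_d}$. Put $V_t=\langle e_1,\dots,e_t\rangle$ and $V^t=\langle e_n,\dots,e_{n-t+1}\rangle$. For $w,v\in I_{d,n}$ let $$X_w=\{U\in G_{d,n}:\dim(U\cap V_{w_t})\ge t,\ 1\le t\le d\},\qquad X^v=\{U\in G_{d,n}:\dim(U\cap V^{\,n-v_{d-t+1}+1})\ge t,\ 1\le t\le d\},$$ and let $X_w^v=X_w\cap X^v$ be the Richardson variety (with its reduced structure), which is assumed to be nonempty. For $X\subseteq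 G_{d,n}$ closed, the homogeneous coordinate ring of $X$ is the quotient of $K[p_i: i\in I_{d,n}]$ by the ideal generated by the homogeneous polynomials vanishing on $X$, with its grading by degree. Let $R_0$ and $R_w^v$ be the homogeneous coordinate rings of $G_{d,n}$ and of $X_w^v$. A monomial $p_{\tau_1}\cdots p_{\tau_m}$ with $\tau_1\ge\dots\ge\tau_m$ is called standard; it is called standard on $X_w^v$ if moreover $w\ge\tau_1$ and $\tau_m\ge v$. (For $m=0$ the empty monomial $1$ is standard, and standard on $X_w^v$.) Then for every integer $m\ge 0$: 1. The standard monomials on $X_w^v$ of degree $m$ are linearly independent in $R_w^v$. 2. Every monomial $p_{\sigma_1}\cdots p_{\sigma_m}$ of degree $m$ in the Plücker coordinates is, in $R_0$, a $K$-linear combination of standard monomials of degree $m$. 3. The standard monomials on $X_w^v$ of degree $m$ form a $K$-basis of the degree $m$ part of $R_w^v$. -/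

import Mathlib

open Module
open scoped LinearAlgebra.Projectivization

noncomputable section

namespace Richardson

/-- The set `I_{d,n}` of strictly increasing `d`-tuples of elements of `{1, …, n}`, with the
componentwise partial order. The number `k ∈ {1, …, n}` is represented by `k - 1 : Fin n`, and
the position `t ∈ {1, …, d}` by `t - 1 : Fin d`. -/
abbrev Index (d n : ℕ) : Type := {i : Fin d → Fin n // StrictMono i}

/-- The Grassmannian `G_{d,n}`: the set of `d`-dimensional subspaces of `K^n`. -/
abbrev Grassmannian (K : Type*) [Field K] (d n : ℕ) : Type _ :=
  {U : Submodule K (Fin n → K) // finrank K U = d}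

section Plucker

variable (K : Type*) [Field K] {d n : ℕ}

/-- The projective space `ℙ(⋀^d K^n)`. -/
abbrev PluckerSpace (d n : ℕ) : Type _ := ℙ K (⋀[K]^d (Fin n → K))

/-- The coordinate function of `e_{i_1} ∧ ⋯ ∧ e_{i_d}` on `⋀^d K^n`, with respect to the basis of
`⋀^d K^n` obtained from the standard basis of `K^n`. -/
def pluckerCoord (i : Index d n) : ⋀[K]^d (Fin n → K) →ₗ[K] K :=
  ((Pi.basisFun K (Fin n)).exteriorPower d).coord
    (Set.powersetCard.ofFinEmbEquiv (OrderEmbedding.ofStrictMono i.1 i.2))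

/-- The Plücker coordinates of `a_1 ∧ ⋯ ∧ a_d` are the maximal minors of the matrix with columns
`a_1, …, a_d`. -/
theorem pluckerCoord_ιMulti (i : Index d n) (a : Fin d → Fin n → K) :
    pluckerCoord K i (exteriorPower.ιMulti K d a) =
      (Matrix.of fun r c : Fin d => a c (i.1 r)).det := by
  rw [pluckerCoord, exteriorPower.basis_coord, exteriorPower.ιMultiDual_apply_ιMulti,
    ← Matrix.det_transpose]
  congr 1
  ext r c
  simp

variable {K}

theorem ιMulti_ne_zero {a : Fin d → Fin n → K} (ha : LinearIndependent K a) :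
    exteriorPower.ιMulti K d a ≠ 0 := by
  have h := (exteriorPower.ιMulti_family_linearIndependent_field d ha).ne_zero
    (Set.powersetCard.ofFinEmbEquiv (OrderEmbedding.ofStrictMono (id : Fin d → Fin d) strictMono_id))
  simpa [exteriorPower.ιMulti_family] using h

/-- A chosen basis of a point of the Grassmannian. -/
def chosenBasis (U : Grassmannian K d n) : Basis (Fin d) K U.1 :=
  finBasisOfFinrankEq K U.1 U.2

theorem linearIndependent_chosenBasis (U : Grassmannian K d n) :
    LinearIndependent K (fun j => (chosenBasis U j : Fin n → K)) :=
  (chosenBasis U).linearIndependent.map' U.1.subtype (Submodule.ker_subtype _)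

/-- The Plücker embedding `G_{d,n} → ℙ(⋀^d K^n)`, sending `U` to `[a_1 ∧ ⋯ ∧ a_d]`, where
`a_1, …, a_d` is a basis of `U`. -/
def plucker (U : Grassmannian K d n) : PluckerSpace K d n :=
  Projectivization.mk K (exteriorPower.ιMulti K d fun j => (chosenBasis U j : Fin n → K))
    (ιMulti_ne_zero (linearIndependent_chosenBasis U))

/-- The Plücker embedding does not depend on the choice of the basis. -/
theorem plucker_eq_mk (U : Grassmannian K d n) (b : Basis (Fin d) K U.1)
    (hb : exteriorPower.ιMulti K d (fun j => (b j : Fin n → K)) ≠ 0) :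
    plucker U = Projectivization.mk K (exteriorPower.ιMulti K d fun j => (b j : Fin n → K)) hb := by
  rw [plucker, Projectivization.mk_eq_mk_iff']
  refine ⟨b.det (chosenBasis U), ?_⟩
  have h : (LinearMap.toSpanSingleton K _ (exteriorPower.ιMulti K d
      fun j => (b j : Fin n → K))).compAlternatingMap b.det =
      (exteriorPower.ιMulti K d).compLinearMap U.1.subtype := by
    refine Basis.ext_alternating b fun v hv => ?_
    obtain ⟨σ, rfl⟩ : ∃ σ : Equiv.Perm (Fin d), v = σ :=
      ⟨Equiv.ofBijective v (Finite.injective_iff_bijective.1 hv), rfl⟩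
    have h₁ := b.det.map_perm b σ
    have h₂ := (exteriorPower.ιMulti K d).map_perm (fun j => (b j : Fin n → K)) σ
    simp only [Function.comp_def] at h₁ h₂
    simp [h₁, h₂, b.det_self, LinearMap.toSpanSingleton_apply]
  have := congrArg (fun f => f (chosenBasis U)) h
  simpa [Function.comp_def] using this

end Plucker

section Varieties

variable (K : Type*) [Field K] {d n : ℕ}

/-- `V_t`, the span of the first `t` standard basis vectors `e_1, …, e_t` of `K^n`. -/
def initialFlag (n t : ℕ) : Submodule K (Fin n → K) :=
  Submodule.span K {x | ∃ j : Fin n, j.val + 1 ≤ t ∧ x = Pi.single j 1}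

/-- `V^t`, the span of the last `t` standard basis vectors `e_n, …, e_{n-t+1}` of `K^n`. -/
def finalFlag (n t : ℕ) : Submodule K (Fin n → K) :=
  Submodule.span K {x | ∃ j : Fin n, n + 1 ≤ (j.val + 1) + t ∧ x = Pi.single j 1}

/-- The Schubert variety `X_i`: the `U` with `dim (U ∩ V_{i_t}) ≥ t` for `1 ≤ t ≤ d`. -/
def schubertVariety (i : Index d n) : Set (Grassmannian K d n) :=
  {U | ∀ t : Fin d, t.val + 1 ≤ finrank K ↥(U.1 ⊓ initialFlag K n ((i.1 t).val + 1))}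

/-- The opposite Schubert variety `X^i`: the `U` with `dim (U ∩ V^{n - i_{d-t+1} + 1}) ≥ t` for
`1 ≤ t ≤ d`. -/
def oppositeSchubertVariety (i : Index d n) : Set (Grassmannian K d n) :=
  {U | ∀ t : Fin d,
    t.val + 1 ≤ finrank K ↥(U.1 ⊓ finalFlag K n (n - ((i.1 t.rev).val + 1) + 1))}

/-- The Richardson variety `X_w^v = X_w ∩ X^v`. -/
def richardsonVariety (w v : Index d n) : Set (Grassmannian K d n) :=
  schubertVariety K w ∩ oppositeSchubertVariety K v

end Varieties

section CoordinateRing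

variable {K : Type*} [Field K] {d n : ℕ}

/-- The homogeneous vanishing ideal of a subset `Y` of `ℙ(⋀^d K^n)`: the ideal of the polynomial
ring in the variables `p_i`, `i ∈ I_{d,n}`, generated by the homogeneous polynomials that vanish at
every point of `Y` when the `p_i` are evaluated at the coordinates of the point. -/
def vanishingIdeal (Y : Set (PluckerSpace K d n)) : Ideal (MvPolynomial (Index d n) K) :=
  Ideal.span {f | (∃ k : ℕ, f.IsHomogeneous k) ∧
    ∀ (x : ⋀[K]^d (Fin n → K)) (hx : x ≠ 0), Projectivization.mk K x hx ∈ Y →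
      MvPolynomial.eval (fun i => pluckerCoord K i x) f = 0}

/-- The homogeneous coordinate ring, for the Plücker embedding, of a subset `X` of `G_{d,n}`
(with the reduced structure when `X` is closed). -/
abbrev CoordinateRing (X : Set (Grassmannian K d n)) : Type _ :=
  MvPolynomial (Index d n) K ⧸ vanishingIdeal (plucker '' X)

/-- The degree `m` part of the homogeneous coordinate ring of `X`: the classes of the homogeneous
polynomials of degree `m`. -/
def degreePart (X : Set (Grassmannian K d n)) (m : ℕ) : Submodule K (CoordinateRing X) :=
  (MvPolynomial.homogeneousSubmodule (Index d n) K m).map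
    (Ideal.Quotient.mkₐ K (vanishingIdeal (plucker '' X))).toLinearMap

/-- The monomial `p_{τ_1} ⋯ p_{τ_m}` in the homogeneous coordinate ring of `X`. -/
def monomial (X : Set (Grassmannian K d n)) {m : ℕ} (τ : Fin m → Index d n) : CoordinateRing X :=
  Ideal.Quotient.mk (vanishingIdeal (plucker '' X)) (∏ t, MvPolynomial.X (τ t))

end CoordinateRing

/-- The monomial `p_{τ_1} ⋯ p_{τ_m}` is standard: `τ_1 ≥ ⋯ ≥ τ_m`. -/
def IsStandard {d n m : ℕ} (τ : Fin m → Index d n) : Prop := Antitone τ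

/-- The monomial `p_{τ_1} ⋯ p_{τ_m}` is standard on `X_w^v`: it is standard, `w ≥ τ_1` and
`τ_m ≥ v`. The last two conditions are void for the empty monomial. -/
def IsStandardOn {d n m : ℕ} (w v : Index d n) (τ : Fin m → Index d n) : Prop :=
  IsStandard τ ∧ ∀ hm : 0 < m, τ ⟨0, hm⟩ ≤ w ∧ v ≤ τ ⟨m - 1, Nat.sub_lt hm one_pos⟩

end Richardson

end

/-! Spanning is straightening. If τ ≱ σ, say τ_s < σ_s, then rows τ_1, …, τ_s, σ_s, …, σ_d of a
d-column matrix are d + 1 vectors in K^d, so the shuffle sum of products of two minors over these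
rows vanishes (`shuffle_relation`). Every other term moves a larger row into the first factor,
raising its entry sum while the total stays fixed (`mul_mem_span_of_not_le`). With the factor of
larger entry sum first, the sum of squares of the entry sums increases, so rewriting stops. On
X_w^v, p_τ vanishes unless v ≤ τ ≤ w, which kills the standard monomials that are not standard on
X_w^v.

Independence comes from a leading-term argument. A matrix whose column c is supported on rows v_c,
…, w_c spans a point of X_w^v as soon as its columns are independent. With weight r·c on the entry
x_{r,c}, the rearrangement inequality makes the diagonal product the leading term of each minor
(`coeff_prod_minor`), and the leading exponent of a standard monomial determines it
(`eq_of_exponent_eq`). Over an infinite field this independence of polynomials passes to functions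
on X_w^v. -/

noncomputable section

namespace Richardson

/-! ### Vanishing ideals tested on minors -/

section Minor

variable {K : Type*} [Field K] {d n : ℕ}

/-- The minor, on the rows `g`, of the matrix with columns `a`. -/
def minor {R : Type*} [CommRing R] (a : Fin d → Fin n → R) (g : Fin d → Fin n) : R :=
  (Matrix.of fun r c : Fin d => a c (g r)).det

theorem eval_smul_of_isHomogeneous {σ R : Type*} [CommRing R] {f : MvPolynomial σ R} {k : ℕ}
    (hf : f.IsHomogeneous k) (c : R) (y : σ → R) :
    MvPolynomial.eval (fun i => c * y i) f = c ^ k * MvPolynomial.eval y f := by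
  rw [MvPolynomial.eval_eq, MvPolynomial.eval_eq, Finset.mul_sum]
  refine Finset.sum_congr rfl fun e he => ?_
  have hk : ∑ i ∈ e.support, e i = k := by
    have := hf (MvPolynomial.mem_support_iff.1 he)
    rwa [Finsupp.weight_apply, Finsupp.sum, Finset.sum_congr rfl fun i _ => by
      rw [Pi.one_apply, smul_eq_mul, mul_one]] at this
  simp_rw [mul_pow, Finset.prod_mul_distrib, Finset.prod_pow_eq_pow_sum, hk]
  ring

/-- Representatives of a point differ by a scalar, which a homogeneous form turns into a power; one
basis per point is enough. -/
theorem mem_vanishingIdeal {X : Set (Grassmannian K d n)} {f : MvPolynomial (Index d n) K} {k : ℕ}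
    (hf : f.IsHomogeneous k)
    (h : ∀ U ∈ X, MvPolynomial.eval
      (fun i : Index d n => minor (fun j => (chosenBasis U j : Fin n → K)) i.1) f = 0) :
    f ∈ vanishingIdeal (plucker '' X) := by
  refine Ideal.subset_span ⟨⟨k, hf⟩, ?_⟩
  rintro x hx ⟨U, hU, hUx⟩
  obtain ⟨c, hc⟩ := (Projectivization.mk_eq_mk_iff' _ _ _ _ _).1 hUx.symm
  have : (fun i => pluckerCoord K i x) = fun i : Index d n =>
      c * minor (fun j => (chosenBasis U j : Fin n → K)) i.1 := by
    funext i
    rw [← hc, map_smul, pluckerCoord_ιMulti, smul_eq_mul, minor]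
  rw [this, eval_smul_of_isHomogeneous hf, h U hU, mul_zero]

/-- Evaluation at a fixed basis is a ring map killing the generators, so `f` need not be
homogeneous. -/
theorem eval_eq_zero_of_mem_vanishingIdeal {X : Set (Grassmannian K d n)}
    {f : MvPolynomial (Index d n) K} (hf : f ∈ vanishingIdeal (plucker '' X))
    {U : Grassmannian K d n} (hU : U ∈ X) (b : Basis (Fin d) K U.1) :
    MvPolynomial.eval (fun i : Index d n => minor (fun j => (b j : Fin n → K)) i.1) f = 0 := by
  suffices h : vanishingIdeal (plucker '' X) ≤ RingHom.ker (MvPolynomial.eval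
      (fun i : Index d n => minor (fun j => (b j : Fin n → K)) i.1)) from h hf
  refine Ideal.span_le.2 ?_
  rintro g ⟨-, hg⟩
  have hb := ιMulti_ne_zero (b.linearIndependent.map' U.1.subtype (Submodule.ker_subtype _))
  have := hg _ hb ⟨U, hU, plucker_eq_mk U b hb⟩
  simp_rw [pluckerCoord_ιMulti] at this
  exact this

theorem vanishingIdeal_anti {X Y : Set (Grassmannian K d n)} (h : X ⊆ Y) :
    vanishingIdeal (K := K) (plucker '' Y) ≤ vanishingIdeal (plucker '' X) :=
  Ideal.span_mono fun _ hf => ⟨hf.1, fun x hx hm => hf.2 x hx (Set.image_mono h hm)⟩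

end Minor

/-! ### Quadratic Plücker relations -/

section Straightening

variable {K : Type*} [Field K] {d n : ℕ}

/-- The sum of the entries of a tuple. -/
def entrySum (g : Fin d → Fin n) : ℕ := ∑ j, (g j : ℕ)

variable (K) in
/-- The linear form in the Plücker coordinates whose values are the minors on the rows `g`. -/
def bracket (g : Fin d → Fin n) : MvPolynomial (Index d n) K :=
  if h : Function.Injective g then
    MvPolynomial.C ((Equiv.Perm.sign (Tuple.sort g) : ℤ) : K) * MvPolynomial.X
      ⟨g ∘ Tuple.sort g,
        (Tuple.monotone_sort g).strictMono_of_injective (h.comp (Equiv.injective _))⟩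
  else 0

theorem bracket_eq (g : Fin d → Fin n) :
    bracket K g = 0 ∨ ∃ (c : K) (i : Index d n), entrySum i.1 = entrySum g ∧
      bracket K g = MvPolynomial.C c * MvPolynomial.X i := by
  by_cases h : Function.Injective g
  · refine Or.inr ⟨_, _, ?_, by rw [bracket, dif_pos h]⟩
    exact Equiv.sum_comp (Tuple.sort g) fun j => (g j : ℕ)
  · exact Or.inl (by rw [bracket, dif_neg h])

theorem isHomogeneous_bracket (g : Fin d → Fin n) : (bracket K g).IsHomogeneous 1 := by
  rcases bracket_eq (K := K) g with h | ⟨c, i, -, h⟩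
  · rw [h]; exact MvPolynomial.isHomogeneous_zero _ _ _
  · rw [h]; exact (MvPolynomial.isHomogeneous_X K i).C_mul c

theorem eval_bracket (a : Fin d → Fin n → K) (g : Fin d → Fin n) :
    MvPolynomial.eval (fun i : Index d n => minor a i.1) (bracket K g) = minor a g := by
  by_cases h : Function.Injective g
  · rw [bracket, dif_pos h, map_mul, MvPolynomial.eval_C, MvPolynomial.eval_X]
    have := Matrix.det_permute (Tuple.sort g) (Matrix.of fun r c : Fin d => a c (g r))
    have h2 : minor a (g ∘ Tuple.sort g) =
      ((Equiv.Perm.sign (Tuple.sort g) : ℤ) : K) * minor a g := this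
    rw [h2, ← mul_assoc, ← Int.cast_mul, ← Units.val_mul, Int.units_mul_self]
    simp
  · rw [bracket, dif_neg h, map_zero, minor]
    obtain ⟨r, s, hrs, hne⟩ : ∃ r s, g r = g s ∧ r ≠ s := by
      simpa [Function.Injective] using h
    exact (Matrix.det_zero_of_row_eq hne (by funext c; simp [hrs])).symm

open TensorProduct in
/-- The shuffle sum of two alternating forms vanishes on linearly dependent families. -/
theorem shuffle_relation {M α β : Type*} [AddCommGroup M] [Module K M] [Fintype α] [Fintype β]
    [DecidableEq α] [DecidableEq β] (a : M [⋀^α]→ₗ[K] K) (b : M [⋀^β]→ₗ[K] K) (v : α ⊕ β → M)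
    (hv : ¬ LinearIndependent K v) :
    a (fun x => v (Sum.inl x)) * b (fun y => v (Sum.inr y)) +
      ∑ q ∈ (Finset.univ : Finset (Equiv.Perm.ModSumCongr α β)).erase
          (QuotientGroup.mk (1 : Equiv.Perm (α ⊕ β))),
        ((Equiv.Perm.sign q.out : ℤ) : K) *
          (a (fun x => v (q.out (Sum.inl x))) * b (fun y => v (q.out (Sum.inr y)))) = 0 := by
  -- Summands are indexed by cosets of S_α × S_β; each may be computed on any representative.
  have key : ∀ ρ : Equiv.Perm (α ⊕ β), TensorProduct.lid K K
      (AlternatingMap.domCoprod.summand a b (QuotientGroup.mk ρ) v) =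
        ((Equiv.Perm.sign ρ : ℤ) : K) *
          (a (fun x => v (ρ (Sum.inl x))) * b (fun y => v (ρ (Sum.inr y)))) := by
    intro ρ
    have : AlternatingMap.domCoprod.summand a b (QuotientGroup.mk ρ) v =
        Equiv.Perm.sign ρ • ((a fun x => v (ρ (Sum.inl x))) ⊗ₜ[K] b fun y => v (ρ (Sum.inr y))) :=
      rfl
    rw [this, Units.smul_def, map_zsmul, TensorProduct.lid_tmul, zsmul_eq_mul, smul_eq_mul]
  have h0 := (a.domCoprod b).map_linearDependent v hv
  rw [AlternatingMap.domCoprod_apply, sum_apply] at h0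
  have h1 := congrArg (TensorProduct.lid K K) h0
  rw [map_sum, map_zero, ← Finset.add_sum_erase _ _ (Finset.mem_univ
    (QuotientGroup.mk (1 : Equiv.Perm (α ⊕ β)))), key 1] at h1
  rw [← h1]
  congr 1
  · simp
  · refine Finset.sum_congr rfl fun q _ => ?_
    rw [← key, QuotientGroup.out_eq']

/-- An alternating form restricted to the slots satisfying `P`, the other slots being fixed. -/
def fixSlots {M ι : Type*} [AddCommGroup M] [Module K M] [DecidableEq ι]
    (f : M [⋀^ι]→ₗ[K] K) (P : ι → Prop) [DecidablePred P] (z : ι → M) :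
    M [⋀^{j // P j}]→ₗ[K] K where
  __ := f.toMultilinearMap.domDomRestrict P (fun j => z j)
  map_eq_zero_of_eq' u i j huv hij := by
    refine f.map_eq_zero_of_eq (i := i.1) (j := j.1) _ ?_ (Subtype.coe_injective.ne hij)
    simpa [i.2, j.2] using huv

theorem fixSlots_apply {M ι : Type*} [AddCommGroup M] [Module K M] [DecidableEq ι]
    (f : M [⋀^ι]→ₗ[K] K) (P : ι → Prop) [DecidablePred P] (z : ι → M) (u : {j // P j} → M) :
    fixSlots f P z u = f fun j => if h : P j then u ⟨j, h⟩ else z j := rfl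

/-- The tuple `z` with the entries in the slots satisfying `P` replaced by `u`. -/
def replaceSlots {ι γ : Type*} (P : ι → Prop) [DecidablePred P] (z : ι → γ)
    (u : {j // P j} → γ) (j : ι) : γ := if h : P j then u ⟨j, h⟩ else z j

theorem replaceSlots_self {ι γ : Type*} (P : ι → Prop) [DecidablePred P] (z : ι → γ) :
    replaceSlots P z (fun j => z j) = z := by
  funext j; simp [replaceSlots]

theorem entrySum_replaceSlots (P : Fin d → Prop) [DecidablePred P] (z : Fin d → Fin n)
    (u : {j // P j} → Fin n) :
    entrySum (replaceSlots P z u) + ∑ x : {j // P j}, (z x : ℕ) =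
      entrySum z + ∑ x, (u x : ℕ) := by
  have h : ∀ y : Fin d → Fin n, entrySum y =
      ∑ x : {j // P j}, (y x : ℕ) + ∑ x : {j // ¬ P j}, (y x : ℕ) := fun y =>
    (Fintype.sum_subtype_add_sum_subtype P fun j => (y j : ℕ)).symm
  have h1 : ∑ x : {j // P j}, ((replaceSlots P z u x : Fin n) : ℕ) = ∑ x, (u x : ℕ) :=
    Finset.sum_congr rfl fun x _ => by simp [replaceSlots, x.2]
  have h2 : ∑ x : {j // ¬ P j}, ((replaceSlots P z u x : Fin n) : ℕ) = ∑ x : {j // ¬ P j}, (z x : ℕ) :=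
    Finset.sum_congr rfl fun x _ => by simp [replaceSlots, x.2]
  rw [h (replaceSlots P z u), h z, h1, h2]
  ring

theorem minor_replaceSlots (a : Fin d → Fin n → K) (P : Fin d → Prop) [DecidablePred P]
    (z : Fin d → Fin n) (u : {j // P j} → Fin n) :
    fixSlots Matrix.detRowAlternating P (fun j c => a c (z j)) (fun x c => a c (u x)) =
      minor a (replaceSlots P z u) := by
  rw [fixSlots_apply, minor]
  change Matrix.det _ = _
  congr 1
  funext r c
  by_cases h : P r <;> simp [replaceSlots, h]

/-- A permutation moving an element of the small part of a disjoint union to the large part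
increases the sum over the small part. -/
theorem sum_inl_lt_sum_perm_inl {α β : Type*} [Fintype α] [Fintype β] (f : α ⊕ β → ℕ) (m : ℕ)
    (hα : ∀ x, f (Sum.inl x) ≤ m) (hβ : ∀ y, m < f (Sum.inr y)) (ρ : Equiv.Perm (α ⊕ β))
    {x₀ : α} {y₀ : β} (h : ρ (Sum.inl x₀) = Sum.inr y₀) :
    ∑ x, f (Sum.inl x) < ∑ x, f (ρ (Sum.inl x)) := by
  -- Truncating `f - m` at 0 removes the large part and leaves the small part unchanged. The total
  -- is invariant under `ρ`, and truncation loses something at `x₀`.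
  have hs : ∑ z, min ((f z : ℤ) - m) 0 = ∑ x, ((f (Sum.inl x) : ℤ) - m) := by
    rw [Fintype.sum_sum_type, Finset.sum_congr rfl fun y _ =>
      min_eq_right (by have := hβ y; lia : (0 : ℤ) ≤ (f (Sum.inr y) : ℤ) - m),
      Finset.sum_const_zero, add_zero]
    exact Finset.sum_congr rfl fun x _ => min_eq_left (by have := hα x; lia)
  have hle : ∑ z, min ((f (ρ z) : ℤ) - m) 0 ≤ ∑ x, min ((f (ρ (Sum.inl x)) : ℤ) - m) 0 := by
    rw [Fintype.sum_sum_type]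
    have : ∑ y, min ((f (ρ (Sum.inr y)) : ℤ) - m) 0 ≤ 0 :=
      Finset.sum_nonpos fun y _ => min_le_right _ _
    linarith
  have hlt : ∑ x, min ((f (ρ (Sum.inl x)) : ℤ) - m) 0 < ∑ x, ((f (ρ (Sum.inl x)) : ℤ) - m) := by
    refine Finset.sum_lt_sum (fun x _ => min_le_left _ _) ⟨x₀, Finset.mem_univ _, ?_⟩
    have := hβ y₀
    rw [h]
    exact lt_of_le_of_lt (min_le_right _ _) (by lia)
  rw [Equiv.sum_comp ρ fun z => min ((f z : ℤ) - m) 0, hs] at hle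
  have := hle.trans_lt hlt
  rw [Finset.sum_sub_distrib, Finset.sum_sub_distrib] at this
  have h3 := (sub_lt_sub_iff_right _).1 this
  exact_mod_cast h3

/-- A permutation preserving the left summand lies in S_α × S_β, the trivial coset. -/
theorem exists_inl_eq_inr {α β : Type*} [Finite α] [Finite β] (q : Equiv.Perm.ModSumCongr α β)
    (hq : q ≠ QuotientGroup.mk (1 : Equiv.Perm (α ⊕ β))) :
    ∃ x y, q.out (Sum.inl x) = Sum.inr y := by
  by_contra! hc
  apply hq
  rw [← QuotientGroup.out_eq' q, eq_comm, QuotientGroup.eq, inv_one, one_mul]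
  apply Equiv.Perm.mem_sumCongrHom_range_of_perm_mapsTo_inl
  rintro _ ⟨x, rfl⟩
  rcases h : q.out (Sum.inl x) with x' | y
  · exact ⟨x', rfl⟩
  · exact absurd h (hc x y)

/-- The product of two Plücker coordinates `p_τ`, `p_σ` with `τ ≱ σ`, rewritten by a quadratic
Plücker relation. -/
theorem mul_mem_span_of_not_le (τ σ : Index d n) (h : ¬ σ ≤ τ) :
    Ideal.Quotient.mk (vanishingIdeal (K := K) (plucker '' (Set.univ : Set (Grassmannian K d n))))
        (MvPolynomial.X τ * MvPolynomial.X σ) ∈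
      Submodule.span K {f | ∃ α β : Index d n, entrySum τ.1 < entrySum α.1 ∧
        entrySum α.1 + entrySum β.1 = entrySum τ.1 + entrySum σ.1 ∧
        f = Ideal.Quotient.mk (vanishingIdeal (plucker '' Set.univ))
          (MvPolynomial.X α * MvPolynomial.X β)} := by
  obtain ⟨s, hs⟩ : ∃ s, τ.1 s < σ.1 s := by
    by_contra! hc
    exact h hc
  -- Slot `s` occurs on both sides, which gives d + 1 rows.
  let v : {j // j ≤ s} ⊕ {j // s ≤ j} → Fin n := Sum.elim (fun x => τ.1 x) fun y => σ.1 y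
  let S := (Finset.univ : Finset (Equiv.Perm.ModSumCongr {j // j ≤ s} {j // s ≤ j})).erase
    (QuotientGroup.mk 1)
  let g (q : Equiv.Perm.ModSumCongr {j // j ≤ s} {j // s ≤ j}) : Fin d → Fin n :=
    replaceSlots (· ≤ s) τ.1 fun x => v (q.out (Sum.inl x))
  let g' (q : Equiv.Perm.ModSumCongr {j // j ≤ s} {j // s ≤ j}) : Fin d → Fin n :=
    replaceSlots (s ≤ ·) σ.1 fun y => v (q.out (Sum.inr y))
  let Q : MvPolynomial (Index d n) K := ∑ q ∈ S,
    MvPolynomial.C ((Equiv.Perm.sign q.out : ℤ) : K) * (bracket K (g q) * bracket K (g' q))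
  have hmem : MvPolynomial.X τ * MvPolynomial.X σ + Q ∈
      vanishingIdeal (plucker '' (Set.univ : Set (Grassmannian K d n))) := by
    refine mem_vanishingIdeal (k := 2) (.add ((MvPolynomial.isHomogeneous_X K τ).mul
      (MvPolynomial.isHomogeneous_X K σ)) (.sum _ _ _ fun q _ =>
        ((isHomogeneous_bracket _).mul (isHomogeneous_bracket _)).C_mul _)) fun U _ => ?_
    set a : Fin d → Fin n → K := fun j => (chosenBasis U j : Fin n → K)
    have hdep : ¬ LinearIndependent K fun z (c : Fin d) => a c (v z) := fun hli => by
      have h1 := hli.fintype_card_le_finrank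
      rw [Fintype.card_sum, finrank_fin_fun, Fintype.card_subtype, Fintype.card_subtype,
        Finset.filter_ge_eq_Iic, Finset.filter_le_eq_Ici, Fin.card_Iic, Fin.card_Ici] at h1
      have := s.2
      lia
    have := shuffle_relation
      (fixSlots Matrix.detRowAlternating (· ≤ s) fun j c => a c (τ.1 j))
      (fixSlots Matrix.detRowAlternating (s ≤ ·) fun j c => a c (σ.1 j)) _ hdep
    simp only [minor_replaceSlots a] at this
    rw [← this]
    simp only [map_add, map_mul, map_sum, MvPolynomial.eval_X, MvPolynomial.eval_C, eval_bracket, Q]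
    congr 3
    · exact (replaceSlots_self (· ≤ s) τ.1).symm
    · exact (replaceSlots_self (s ≤ ·) σ.1).symm
  have heq := Ideal.Quotient.eq_zero_iff_mem.2 hmem
  rw [map_add, add_eq_zero_iff_eq_neg] at heq
  rw [heq, map_sum]
  refine neg_mem (sum_mem fun q hq => ?_)
  obtain ⟨x₀, y₀, hxy⟩ := exists_inl_eq_inr q (Finset.ne_of_mem_erase hq)
  -- The threshold τ_s separates the rows: τ_j ≤ τ_s < σ_s ≤ σ_k for j ≤ s ≤ k.
  have hlt := sum_inl_lt_sum_perm_inl (fun z => (v z : ℕ)) (τ.1 s) (fun x => τ.2.monotone x.2)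
    (fun y => lt_of_lt_of_le hs (σ.2.monotone y.2)) q.out hxy
  have htot := Equiv.sum_comp q.out fun z => (v z : ℕ)
  rw [Fintype.sum_sum_type, Fintype.sum_sum_type] at htot
  have h1 := entrySum_replaceSlots (· ≤ s) τ.1 fun x => v (q.out (Sum.inl x))
  have h2 := entrySum_replaceSlots (s ≤ ·) σ.1 fun y => v (q.out (Sum.inr y))
  rcases bracket_eq (K := K) (g q) with hb | ⟨c, α, hα, hb⟩
  · simp [hb]
  rcases bracket_eq (K := K) (g' q) with hb' | ⟨c', β, hβ, hb'⟩
  · simp [hb']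
  have : MvPolynomial.C ((Equiv.Perm.sign q.out : ℤ) : K) * (bracket K (g q) * bracket K (g' q)) =
      (((Equiv.Perm.sign q.out : ℤ) : K) * c * c') •
        (MvPolynomial.X α * MvPolynomial.X β : MvPolynomial (Index d n) K) := by
    rw [hb, hb', MvPolynomial.smul_eq_C_mul, map_mul, map_mul]
    ring
  rw [this, ← Ideal.Quotient.mkₐ_eq_mk K, map_smul]
  refine Submodule.smul_mem _ _ (Submodule.subset_span ?_)
  refine ⟨α, β, ?_, ?_, rfl⟩
  all_goals simp only [v, g, g', Sum.elim_inl, Sum.elim_inr] at *; lia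

end Straightening


/-! ### Spanning by standard monomials -/

section Spanning

variable {K : Type*} [Field K] {d n : ℕ}

theorem entrySum_mono {σ τ : Index d n} (h : σ ≤ τ) : entrySum σ.1 ≤ entrySum τ.1 :=
  Finset.sum_le_sum fun j _ => h j

theorem eq_of_le_of_entrySum_le {σ τ : Index d n} (h : σ ≤ τ)
    (hs : entrySum τ.1 ≤ entrySum σ.1) : σ = τ := by
  have := (Finset.sum_eq_sum_iff_of_le fun j _ => show (σ.1 j : ℕ) ≤ (τ.1 j : ℕ) from h j).1
    (le_antisymm (entrySum_mono h) hs)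
  exact Subtype.ext (funext fun j => Fin.ext (this j (Finset.mem_univ j)))

theorem monomial_eq_prod (X : Set (Grassmannian K d n)) {m : ℕ} (τ : Fin m → Index d n) :
    monomial X τ = ∏ t, Ideal.Quotient.mk (vanishingIdeal (plucker '' X)) (MvPolynomial.X (τ t)) :=
  map_prod _ _ _

theorem monomial_comp_perm (X : Set (Grassmannian K d n)) {m : ℕ} (τ : Fin m → Index d n)
    (e : Equiv.Perm (Fin m)) : monomial X (τ ∘ e) = monomial X τ := by
  rw [monomial_eq_prod, monomial_eq_prod]
  exact Equiv.prod_comp e fun t => Ideal.Quotient.mk (vanishingIdeal (plucker '' X))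
    (MvPolynomial.X (τ t))

/-- A family of pairwise comparable indices can be sorted. -/
theorem exists_perm_isStandard {m : ℕ} (τ : Fin m → Index d n)
    (h : ∀ i j, τ i ≤ τ j ∨ τ j ≤ τ i) : ∃ e : Equiv.Perm (Fin m), IsStandard (τ ∘ e) := by
  -- Among comparable indices the entry sum determines the order; `OrderDual` makes the sort
  -- decreasing.
  refine ⟨Tuple.sort fun i => OrderDual.toDual (entrySum (τ i).1), fun i j hij => ?_⟩
  have hm : entrySum (τ (Tuple.sort (fun i => OrderDual.toDual (entrySum (τ i).1)) j)).1 ≤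
      entrySum (τ (Tuple.sort (fun i => OrderDual.toDual (entrySum (τ i).1)) i)).1 :=
    Tuple.monotone_sort (fun i => OrderDual.toDual (entrySum (τ i).1)) hij
  rcases h (Tuple.sort (fun i => OrderDual.toDual (entrySum (τ i).1)) i)
    (Tuple.sort (fun i => OrderDual.toDual (entrySum (τ i).1)) j) with h1 | h1
  · exact (eq_of_le_of_entrySum_le h1 hm).ge
  · exact h1

/-- The standard monomials span the monomials in the homogeneous coordinate ring of the
Grassmannian. -/
theorem monomial_mem_span_isStandard {m : ℕ} (σ : Fin m → Index d n) :
    monomial (Set.univ : Set (Grassmannian K d n)) σ ∈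
      Submodule.span K {f | ∃ τ : Fin m → Index d n,
        IsStandard τ ∧ f = monomial (Set.univ : Set (Grassmannian K d n)) τ} := by
  -- Straightening increases `M`; the induction is well founded because there are finitely many
  -- families.
  let M (τ : Fin m → Index d n) : ℕ := ∑ t, entrySum (τ t).1 ^ 2
  have : IsTrans (Fin m → Index d n) fun τ σ => M σ < M τ := ⟨fun _ _ _ h h' => h'.trans h⟩
  have : Std.Irrefl fun τ σ : Fin m → Index d n => M σ < M τ := ⟨fun _ => lt_irrefl _⟩
  induction σ using (Finite.wellFounded_of_trans_of_irrefl
    fun τ σ : Fin m → Index d n => M σ < M τ).induction with | _ σ ih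
  by_cases hc : ∀ i j, σ i ≤ σ j ∨ σ j ≤ σ i
  · obtain ⟨e, he⟩ := exists_perm_isStandard σ hc
    rw [← monomial_comp_perm _ σ e]
    exact Submodule.subset_span ⟨_, he, rfl⟩
  -- Incomparability fails both inequalities, so the factor of larger entry sum can be the one that
  -- grows.
  obtain ⟨i, j, hle, hji⟩ : ∃ i j, entrySum (σ j).1 ≤ entrySum (σ i).1 ∧ ¬ σ j ≤ σ i := by
    push Not at hc
    obtain ⟨i, j, h1, h2⟩ := hc
    rcases le_total (entrySum (σ j).1) (entrySum (σ i).1) with h | h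
    · exact ⟨i, j, h, h2⟩
    · exact ⟨j, i, h, h1⟩
  have hij : i ≠ j := fun h => hji (h ▸ le_rfl)
  let p (α : Index d n) : CoordinateRing (Set.univ : Set (Grassmannian K d n)) :=
    Ideal.Quotient.mk _ (MvPolynomial.X α)
  let rest := ∏ t ∈ (Finset.univ.erase i).erase j, p (σ t)
  have hj : j ∈ Finset.univ.erase i := by simp [hij.symm]
  have hupd (α β : Index d n) : monomial (Set.univ : Set (Grassmannian K d n))
      (Function.update (Function.update σ i α) j β) = p α * p β * rest := by
    rw [monomial_eq_prod, ← Finset.mul_prod_erase _ _ (Finset.mem_univ i),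
      ← Finset.mul_prod_erase _ _ hj, ← mul_assoc]
    refine congrArg₂ _ (by simp [hij, p]) (Finset.prod_congr rfl fun t ht => ?_)
    have h1 := Finset.ne_of_mem_erase ht
    have h2 := Finset.ne_of_mem_erase (Finset.mem_of_mem_erase ht)
    simp [h1, h2, p]
  have hσ : monomial (Set.univ : Set (Grassmannian K d n)) σ = p (σ i) * p (σ j) * rest := by
    rw [← hupd, Function.update_eq_self_iff.2 rfl, Function.update_eq_self_iff.2]
    simp
  have hmem := Submodule.mem_map_of_mem (f := LinearMap.mulRight K rest)
    (mul_mem_span_of_not_le (K := K) (σ i) (σ j) hji)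
  rw [map_mul, LinearMap.mulRight_apply, Submodule.map_span] at hmem
  rw [hσ]
  refine Submodule.span_le.2 ?_ hmem
  rintro _ ⟨_, ⟨α, β, hα, hαβ, rfl⟩, rfl⟩
  rw [LinearMap.mulRight_apply, map_mul]
  have := ih (Function.update (Function.update σ i α) j β) ?_
  · rw [hupd] at this
    exact this
  · simp only [M]
    rw [← Finset.add_sum_erase _ _ (Finset.mem_univ i), ← Finset.add_sum_erase _ _ hj,
      ← Finset.add_sum_erase (Finset.univ) _ (Finset.mem_univ i), ← Finset.add_sum_erase _ _ hj,
      ← add_assoc, ← add_assoc]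
    refine add_lt_add_of_lt_of_le ?_ (Finset.sum_le_sum fun t ht => ?_)
    · simp only [ne_eq, hij, not_false_eq_true, Function.update_of_ne, Function.update_self]
      nlinarith
    · have h1 := Finset.ne_of_mem_erase ht
      have h2 := Finset.ne_of_mem_erase (Finset.mem_of_mem_erase ht)
      simp [h1, h2]

theorem mem_span_single_iff (P : Fin n → Prop) (x : Fin n → K) :
    x ∈ Submodule.span K {x : Fin n → K | ∃ j, P j ∧ x = Pi.single j 1} ↔
      ∀ j, ¬ P j → x j = 0 := by
  constructor
  · intro hx j hj
    induction hx using Submodule.span_induction with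
    | mem x hx =>
      obtain ⟨k, hk, rfl⟩ := hx
      exact Pi.single_eq_of_ne (fun h : j = k => hj (h.symm ▸ hk)) _
    | zero => rfl
    | add x y _ _ hx hy => simp [hx, hy]
    | smul c x _ hx => simp [hx]
  · intro h
    rw [← Finset.univ_sum_single x]
    refine sum_mem fun j _ => ?_
    by_cases hj : P j
    · have := Submodule.smul_mem _ (x j) (Submodule.subset_span (R := K)
        (s := {x : Fin n → K | ∃ j, P j ∧ x = Pi.single j 1}) ⟨j, hj, rfl⟩)
      simpa [← Pi.single_smul] using this
    · simp [h j hj]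

theorem mem_initialFlag {t : Fin n} {x : Fin n → K} :
    x ∈ initialFlag K n (t.val + 1) ↔ ∀ j, t < j → x j = 0 := by
  rw [initialFlag, mem_span_single_iff]
  refine forall_congr' fun j => ?_
  rw [Fin.lt_def]
  exact imp_congr_left (by lia)

theorem mem_finalFlag {t : Fin n} {x : Fin n → K} :
    x ∈ finalFlag K n (n - (t.val + 1) + 1) ↔ ∀ j, j < t → x j = 0 := by
  rw [finalFlag, mem_span_single_iff]
  refine forall_congr' fun j => ?_
  rw [Fin.lt_def]
  exact imp_congr_left (by lia)

/-- If the minor of `U` on the rows `g` is nonzero, a subspace of `U` whose elements vanish in the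
rows `g j` for `j ∉ S` has dimension at most the cardinality of `S`. -/
theorem finrank_inf_le_card {U W : Submodule K (Fin n → K)} (b : Basis (Fin d) K U)
    {g : Fin d → Fin n} (hg : minor (fun j => (b j : Fin n → K)) g ≠ 0) (S : Finset (Fin d))
    (hW : ∀ x ∈ W, ∀ j ∉ S, x (g j) = 0) : finrank K ↥(U ⊓ W) ≤ S.card := by
  let L : ↥(U ⊓ W) →ₗ[K] (S → K) :=
    LinearMap.pi fun j => LinearMap.proj (g j) ∘ₗ (U ⊓ W).subtype
  have hL : Function.Injective L := by
    rw [← LinearMap.ker_eq_bot, LinearMap.ker_eq_bot']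
    rintro ⟨x, hxU, hxW⟩ hx
    have hx0 (j : Fin d) : x (g j) = 0 := by
      by_cases hj : j ∈ S
      · exact congrFun hx ⟨j, hj⟩
      · exact hW x hxW j hj
    -- The coordinates of `x` in `b` are killed by the submatrix on rows `g`, whose determinant is
    -- nonzero.
    have hmul : (Matrix.of fun r c : Fin d => (b c : Fin n → K) (g r)).mulVec
        (b.repr ⟨x, hxU⟩) = 0 := by
      funext r
      have := congrArg (fun y : U => (y : Fin n → K) (g r)) (b.sum_repr ⟨x, hxU⟩)
      simp only [AddSubmonoidClass.coe_finsetSum, Finset.sum_apply, hx0] at this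
      rw [Pi.zero_apply, ← this]
      simp [Matrix.mulVec, dotProduct, mul_comm]
    have h0 := Matrix.eq_zero_of_mulVec_eq_zero hg hmul
    have : (⟨x, hxU⟩ : U) = 0 := b.repr.map_eq_zero_iff.1 (Finsupp.ext fun j => congrFun h0 j)
    exact Subtype.ext (congrArg (Subtype.val : U → _) this)
  simpa using LinearMap.finrank_le_finrank_of_injective hL

/-- If w_t < τ_t, vectors of V_{w_t} vanish in all rows τ_j with j ≥ t, leaving too few dimensions
for the Schubert condition. -/
theorem le_of_minor_ne_zero_of_mem_schubertVariety {w τ : Index d n} {U : Grassmannian K d n}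
    (hU : U ∈ schubertVariety K w) (b : Basis (Fin d) K U.1)
    (h : minor (fun j => (b j : Fin n → K)) τ.1 ≠ 0) : τ ≤ w := by
  by_contra hc
  obtain ⟨t, ht⟩ : ∃ t, w.1 t < τ.1 t := by
    by_contra! hc'
    exact hc hc'
  have h1 := finrank_inf_le_card (W := initialFlag K n ((w.1 t).val + 1)) b h (Finset.Iio t)
    fun x hx j hj => mem_initialFlag.1 hx _ (ht.trans_le (τ.2.monotone (by simpa using hj)))
  have := hU t
  rw [Fin.card_Iio] at h1
  lia

theorem le_of_minor_ne_zero_of_mem_oppositeSchubertVariety {v τ : Index d n}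
    {U : Grassmannian K d n} (hU : U ∈ oppositeSchubertVariety K v) (b : Basis (Fin d) K U.1)
    (h : minor (fun j => (b j : Fin n → K)) τ.1 ≠ 0) : v ≤ τ := by
  by_contra hc
  obtain ⟨t, ht⟩ : ∃ t, τ.1 t < v.1 t := by
    by_contra! hc'
    exact hc hc'
  have h1 := finrank_inf_le_card (W := finalFlag K n (n - ((v.1 t).val + 1) + 1)) b h
    (Finset.Ioi t)
    fun x hx j hj => mem_finalFlag.1 hx _ ((τ.2.monotone (by simpa using hj)).trans_lt ht)
  have h2 := hU t.rev
  rw [Fin.rev_rev, Fin.val_rev] at h2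
  rw [Fin.card_Ioi] at h1
  lia

theorem monomial_eq_zero {w v : Index d n} {m : ℕ} {τ : Fin m → Index d n} {t : Fin m}
    (h : ¬ (τ t ≤ w ∧ v ≤ τ t)) : monomial (richardsonVariety K w v) τ = 0 := by
  rw [monomial_eq_prod]
  refine Finset.prod_eq_zero (Finset.mem_univ t) (Ideal.Quotient.eq_zero_iff_mem.2 ?_)
  refine mem_vanishingIdeal (MvPolynomial.isHomogeneous_X _ _) fun U hU => ?_
  rw [MvPolynomial.eval_X]
  by_contra hc
  exact h ⟨le_of_minor_ne_zero_of_mem_schubertVariety hU.1 _ hc,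
    le_of_minor_ne_zero_of_mem_oppositeSchubertVariety hU.2 _ hc⟩

/-- Straightening on the Grassmannian is pushed to the quotient ring, where a standard monomial with
a factor outside [v, w] is zero. -/
theorem monomial_mem_span_isStandardOn (w v : Index d n) {m : ℕ} (σ : Fin m → Index d n) :
    monomial (richardsonVariety K w v) σ ∈ Submodule.span K (Set.range
      fun τ : {τ : Fin m → Index d n // IsStandardOn w v τ} =>
        monomial (richardsonVariety K w v) τ.1) := by
  let F : CoordinateRing (Set.univ : Set (Grassmannian K d n)) →ₐ[K]
      CoordinateRing (richardsonVariety K w v) :=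
    Ideal.Quotient.factorₐ K (vanishingIdeal_anti (Set.subset_univ _))
  have hF (τ : Fin m → Index d n) : F (monomial Set.univ τ) =
    monomial (richardsonVariety K w v) τ := rfl
  have h := Submodule.mem_map_of_mem (f := F.toLinearMap) (monomial_mem_span_isStandard (K := K) σ)
  rw [Submodule.map_span] at h
  refine Submodule.span_le.2 ?_ h
  rintro _ ⟨_, ⟨τ, hτ, rfl⟩, rfl⟩
  rw [AlgHom.toLinearMap_apply, hF]
  by_cases hs : IsStandardOn w v τ
  · exact Submodule.subset_span ⟨⟨τ, hs⟩, rfl⟩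
  · have : ∃ t, ¬ (τ t ≤ w ∧ v ≤ τ t) := by
      by_contra! hc
      exact hs ⟨hτ, fun hm => ⟨(hc _).1, (hc _).2⟩⟩
    obtain ⟨t, ht⟩ := this
    rw [monomial_eq_zero ht]
    exact zero_mem _

theorem degreePart_eq_span (X : Set (Grassmannian K d n)) (m : ℕ) :
    degreePart X m =
      Submodule.span K (Set.range fun σ : Fin m → Index d n => monomial X σ) := by
  apply le_antisymm
  · rintro _ ⟨f, hf, rfl⟩
    rw [SetLike.mem_coe, MvPolynomial.mem_homogeneousSubmodule] at hf
    rw [f.as_sum, map_sum]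
    refine sum_mem fun e he => ?_
    have hdeg := hf (MvPolynomial.mem_support_iff.1 he)
    have hcard : e.toMultiset.toList.length = m := by
      rw [Multiset.length_toList, Finsupp.card_toMultiset, ← hdeg, Finsupp.weight_apply]
      simp [Finsupp.sum]
    subst hcard
    have hprod : MvPolynomial.monomial e (f.coeff e) = f.coeff e •
        ∏ t, MvPolynomial.X (e.toMultiset.toList.get t) := by
      have := Fin.prod_univ_fun_getElem e.toMultiset.toList
        (MvPolynomial.X : Index d n → MvPolynomial (Index d n) K)
      simp only [List.get_eq_getElem, this]
      rw [← Multiset.prod_coe, ← Multiset.map_coe, Multiset.coe_toList, Finsupp.toMultiset_map,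
        Finsupp.prod_toMultiset, Finsupp.prod_mapDomain_index (by simp) (by simp [pow_add]),
        MvPolynomial.monomial_eq, MvPolynomial.smul_eq_C_mul]
    rw [hprod, map_smul]
    exact Submodule.smul_mem _ _ (Submodule.subset_span ⟨_, rfl⟩)
  · refine Submodule.span_le.2 ?_
    rintro _ ⟨σ, rfl⟩
    refine ⟨_, ?_, rfl⟩
    have := MvPolynomial.IsHomogeneous.prod Finset.univ
      (fun t => (MvPolynomial.X (σ t) : MvPolynomial (Index d n) K)) (fun _ => 1)
      fun t _ => MvPolynomial.isHomogeneous_X K (σ t)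
    simpa using this

end Spanning


/-! ### Leading terms and linear independence -/

section Independence

variable {K : Type*} [Field K] {d n : ℕ}

/-- The generic matrix whose `c`-th column is supported on the rows between `v c` and `w c`. -/
def genericColumns (K : Type*) [Field K] (w v : Index d n) (c : Fin d) (r : Fin n) :
    MvPolynomial (Fin n × Fin d) K :=
  if v.1 c ≤ r ∧ r ≤ w.1 c then MvPolynomial.X (r, c) else 0

/-- The exponent of the monomial `∏ x_{h_k(c), c}`. -/
def exponent {m : ℕ} (h : Fin m → Fin d → Fin n) : Fin n × Fin d →₀ ℕ :=
  ∑ k, ∑ c, Finsupp.single (h k c, c) 1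

theorem weight_exponent {m : ℕ} (h : Fin m → Fin d → Fin n) :
    Finsupp.weight (fun x : Fin n × Fin d => (x.1 : ℕ) * x.2) (exponent h) =
      ∑ k, ∑ c, (h k c : ℕ) * c := by
  simp [exponent, Finsupp.weight_single]

theorem exponent_apply {m : ℕ} (h : Fin m → Fin d → Fin n) (r : Fin n) (c : Fin d) :
    exponent h (r, c) = (Finset.univ.filter fun k => r = h k c).card := by
  simp only [exponent, Finsupp.finsetSum_apply, Finsupp.single_apply, Prod.mk.injEq]
  rw [Finset.card_filter]
  refine Finset.sum_congr rfl fun k _ => ?_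
  rw [Finset.sum_eq_single c (fun c' _ hc => by simp [hc]) (by simp)]
  simp [eq_comm]

/-- For each column c the exponent records the multiset of the τ_k(c); standardness fixes their
order. -/
theorem eq_of_exponent_eq {m : ℕ} {τ τ' : Fin m → Index d n} (hτ : IsStandard τ)
    (hτ' : IsStandard τ') (h : exponent (fun k => (τ k).1) = exponent fun k => (τ' k).1) :
    τ = τ' := by
  have key (c : Fin d) : (fun k => (τ k).1 c) = fun k => (τ' k).1 c := by
    have hm : Multiset.map (fun k => (τ k).1 c) Finset.univ.val =
        Multiset.map (fun k => (τ' k).1 c) Finset.univ.val := by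
      ext r
      have := DFunLike.congr_fun h (r, c)
      rw [exponent_apply, exponent_apply] at this
      rw [Multiset.count_map, Multiset.count_map]
      exact this
    rw [Fin.univ_val_map, Fin.univ_val_map, Multiset.coe_eq_coe] at hm
    exact List.ofFn_injective (hm.eq_of_sortedGE
      (List.sortedGE_ofFn_iff.2 fun i j hij => hτ hij c)
      (List.sortedGE_ofFn_iff.2 fun i j hij => hτ' hij c))
  funext k
  exact Subtype.ext (funext fun c => congrFun (key c) k)

theorem prod_genericColumns {w v : Index d n} {m : ℕ} {h : Fin m → Fin d → Fin n}
    (hr : ∀ k c, v.1 c ≤ h k c ∧ h k c ≤ w.1 c) :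
    ∏ k, ∏ c, genericColumns K w v c (h k c) = MvPolynomial.monomial (exponent h) 1 := by
  simp_rw [genericColumns, if_pos (hr _ _), MvPolynomial.X, exponent,
    MvPolynomial.monomial_sum_one]

theorem coeff_prod_genericColumns_of_ne {w v : Index d n} {m : ℕ} {h : Fin m → Fin d → Fin n}
    {e : Fin n × Fin d →₀ ℕ} (he : e ≠ exponent h) :
    MvPolynomial.coeff e (∏ k, ∏ c, genericColumns K w v c (h k c)) = 0 := by
  by_cases hr : ∀ k c, v.1 c ≤ h k c ∧ h k c ≤ w.1 c
  · rw [prod_genericColumns hr, MvPolynomial.coeff_monomial, if_neg he.symm]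
  · push Not at hr
    obtain ⟨k, c, hkc⟩ := hr
    rw [Finset.prod_eq_zero (Finset.mem_univ k) (Finset.prod_eq_zero (Finset.mem_univ c)
      (if_neg fun h' => (hkc h'.1).not_ge h'.2)), MvPolynomial.coeff_zero]

/-- Rearrangement inequality; it is strict because `i` is strictly increasing. -/
theorem sum_perm_mul_lt (i : Index d n) {σ : Equiv.Perm (Fin d)} (hσ : σ ≠ 1) :
    ∑ c, (i.1 (σ c) : ℕ) * c < ∑ c, (i.1 c : ℕ) * c := by
  have hm : Monovary (fun c => (i.1 c : ℕ)) fun c : Fin d => (c : ℕ) :=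
    fun a b hab => i.2.monotone (le_of_lt hab)
  refine hm.sum_comp_perm_mul_lt_sum_mul_iff.2 fun hc => hσ ?_
  have hmono : Monotone σ := fun a b hab => by
    rcases hab.eq_or_lt with rfl | hab
    · exact le_rfl
    · exact i.2.le_iff_le.1 (hc hab)
  exact DFunLike.coe_injective (((hmono.strictMono_of_injective σ.injective).range_inj
    strictMono_id).1 (by simp [σ.surjective.range_eq]))

theorem sum_perm_mul_le (i : Index d n) (σ : Equiv.Perm (Fin d)) :
    ∑ c, (i.1 (σ c) : ℕ) * c ≤ ∑ c, (i.1 c : ℕ) * c := by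
  by_cases h : σ = 1
  · simp [h]
  · exact (sum_perm_mul_lt i h).le

theorem prod_minor_eq_sum {R : Type*} [CommRing R] (a : Fin d → Fin n → R) {m : ℕ}
    (h : Fin m → Fin d → Fin n) :
    ∏ k, minor a (h k) = ∑ p : Fin m → Equiv.Perm (Fin d),
      (∏ k, ((Equiv.Perm.sign (p k) : ℤ) : R)) * ∏ k, ∏ c, a c (h k (p k c)) := by
  simp_rw [minor, Matrix.det_apply', Finset.prod_univ_sum, Fintype.piFinset_univ,
    Finset.prod_mul_distrib, Matrix.of_apply]

/-- The diagonal monomial is the leading monomial of a product of minors of the generic matrix. -/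
theorem coeff_prod_minor {w v : Index d n} {m : ℕ} {τ : Fin m → Index d n}
    (hτ : ∀ k, v ≤ τ k ∧ τ k ≤ w) {e : Fin n × Fin d →₀ ℕ}
    (he : ∑ k, ∑ c, ((τ k).1 c : ℕ) * c ≤
      Finsupp.weight (fun x : Fin n × Fin d => (x.1 : ℕ) * x.2) e) :
    MvPolynomial.coeff e (∏ k, minor (genericColumns K w v) (τ k).1) =
      if exponent (fun k => (τ k).1) = e then 1 else 0 := by
  rw [prod_minor_eq_sum, MvPolynomial.coeff_sum, Finset.sum_eq_single 1 _ (by simp)]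
  · have := prod_genericColumns (K := K) (w := w) (v := v) (h := fun k => (τ k).1)
      fun k c => ⟨(hτ k).1 c, (hτ k).2 c⟩
    simp [this, MvPolynomial.coeff_monomial]
  · intro p _ hp
    have : ∏ k, ((Equiv.Perm.sign (p k) : ℤ) : MvPolynomial (Fin n × Fin d) K) =
        MvPolynomial.C (∏ k, ((Equiv.Perm.sign (p k) : ℤ) : K)) := by
      simp
    rw [this, MvPolynomial.coeff_C_mul, coeff_prod_genericColumns_of_ne, mul_zero]
    -- A non-identity choice of permutations has strictly smaller weight than the diagonal, against
    -- `he`.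
    rintro rfl
    rw [weight_exponent] at he
    obtain ⟨k, hk⟩ := Function.ne_iff.1 hp
    exact he.not_gt (Finset.sum_lt_sum (fun k _ => sum_perm_mul_le (τ k) (p k))
      ⟨k, Finset.mem_univ k, sum_perm_mul_lt (τ k) hk⟩)

theorem IsStandardOn.mem_Icc {w v : Index d n} {m : ℕ} {τ : Fin m → Index d n}
    (h : IsStandardOn w v τ) (k : Fin m) : v ≤ τ k ∧ τ k ≤ w := by
  have hm : 0 < m := k.pos
  exact ⟨(h.2 hm).2.trans (h.1 (Fin.mk_le_mk.2 (Nat.le_sub_one_of_lt k.2))),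
    (h.1 (Fin.mk_le_mk.2 (Nat.zero_le _))).trans (h.2 hm).1⟩

theorem linearIndependent_prod_minor (w v : Index d n) (m : ℕ) :
    LinearIndependent K fun τ : {τ : Fin m → Index d n // IsStandardOn w v τ} =>
      ∏ k, minor (genericColumns K w v) (τ.1 k).1 := by
  classical
  have := Fintype.ofFinite {τ : Fin m → Index d n // IsStandardOn w v τ}
  rw [Fintype.linearIndependent_iff]
  intro g hg
  by_contra! hne
  obtain ⟨τ₁, hτ₁⟩ := hne
  -- At the exponent of a term of maximal weight, no other term of the relation contributes.
  obtain ⟨τ₀, h₀, hmax⟩ := (Finset.univ.filter fun τ => g τ ≠ 0).exists_max_image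
    (fun τ => ∑ k, ∑ c, ((τ.1 k).1 c : ℕ) * c) ⟨τ₁, by simpa using hτ₁⟩
  have h := congrArg (MvPolynomial.coeff (exponent fun k => (τ₀.1 k).1)) hg
  rw [MvPolynomial.coeff_sum, MvPolynomial.coeff_zero, Finset.sum_eq_single τ₀ _ (by simp),
    MvPolynomial.coeff_smul, coeff_prod_minor τ₀.2.mem_Icc (weight_exponent _).ge, if_pos rfl,
    smul_eq_mul, mul_one] at h
  · exact (Finset.mem_filter.1 h₀).2 h
  · intro τ _ hτ
    by_cases hz : g τ = 0
    · simp [hz]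
    rw [MvPolynomial.coeff_smul, coeff_prod_minor τ.2.mem_Icc, if_neg, smul_zero]
    · exact fun he => hτ (Subtype.ext (eq_of_exponent_eq τ.2.1 τ₀.2.1 he))
    · rw [weight_exponent]
      exact hmax τ (by simpa using hz)

theorem card_le_finrank_inf {a : Fin d → Fin n → K} (ha : LinearIndependent K a)
    {W : Submodule K (Fin n → K)} (S : Finset (Fin d)) (hW : ∀ j ∈ S, a j ∈ W) :
    S.card ≤ finrank K ↥(Submodule.span K (Set.range a) ⊓ W) := by
  have h := finrank_span_eq_card (ha.comp ((↑) : S → Fin d) Subtype.val_injective)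
  rw [Fintype.card_coe] at h
  rw [← h]
  refine Submodule.finrank_mono (Submodule.span_le.2 ?_)
  rintro _ ⟨j, rfl⟩
  exact ⟨Submodule.subset_span ⟨j, rfl⟩, hW j j.2⟩

/-- The subspace spanned by linearly independent columns `a c` supported on the rows between `v c`
and `w c` is a point of the Richardson variety. -/
theorem span_mem_richardsonVariety {w v : Index d n} {a : Fin d → Fin n → K}
    (ha : LinearIndependent K a) (hs : ∀ c r, ¬ (v.1 c ≤ r ∧ r ≤ w.1 c) → a c r = 0) :
    (⟨Submodule.span K (Set.range a), by simpa using finrank_span_eq_card ha⟩ :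
      Grassmannian K d n) ∈ richardsonVariety K w v := by
  refine ⟨fun t => ?_, fun t => ?_⟩
  · rw [← Fin.card_Iic]
    refine card_le_finrank_inf ha _ fun j hj => mem_initialFlag.2 fun r hr => hs j r fun h => ?_
    exact (h.2.trans (w.2.monotone (Finset.mem_Iic.1 hj))).not_gt hr
  · have : t.val + 1 = (Finset.Ici t.rev).card := by
      rw [Fin.card_Ici, Fin.val_rev]
      lia
    rw [this]
    refine card_le_finrank_inf ha _ fun j hj => mem_finalFlag.2 fun r hr => hs j r fun h => ?_
    exact ((v.2.monotone (Finset.mem_Ici.1 hj)).trans h.1).not_gt hr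

theorem minor_eq_zero_of_not_linearIndependent {a : Fin d → Fin n → K}
    (ha : ¬ LinearIndependent K a) (g : Fin d → Fin n) : minor a g = 0 := by
  by_contra h
  refine ha (LinearIndependent.of_comp (LinearMap.funLeft K K g) ?_)
  have := Matrix.linearIndependent_cols_of_det_ne_zero h
  exact this

theorem linearIndependent_monomial [Infinite K] (w v : Index d n)
    (hX : (richardsonVariety K w v).Nonempty) (m : ℕ) :
    LinearIndependent K fun τ : {τ : Fin m → Index d n // IsStandardOn w v τ} =>
      monomial (richardsonVariety K w v) τ.1 := by
  have := Fintype.ofFinite {τ : Fin m → Index d n // IsStandardOn w v τ}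
  rw [Fintype.linearIndependent_iff]
  intro g hg
  have hmem : ∑ τ, MvPolynomial.C (g τ) * ∏ t, MvPolynomial.X (τ.1 t) ∈
      vanishingIdeal (plucker '' richardsonVariety K w v) := by
    rw [← Ideal.Quotient.eq_zero_iff_mem, ← hg, map_sum]
    refine Finset.sum_congr rfl fun τ _ => ?_
    rw [← MvPolynomial.smul_eq_C_mul]
    rfl
  -- In degree 0 the claim is that 1 is nonzero in the coordinate ring, which needs a point of
  -- X_w^v.
  rcases m.eq_zero_or_pos with rfl | hm
  · intro τ
    obtain ⟨U, hU⟩ := hX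
    have h := eval_eq_zero_of_mem_vanishingIdeal hmem hU (chosenBasis U)
    rw [map_sum, Finset.sum_eq_single τ
      (fun τ' _ hne => absurd (Subtype.ext (Subsingleton.elim _ _)) hne) (by simp)] at h
    simpa using h
  refine Fintype.linearIndependent_iff.1 (linearIndependent_prod_minor (K := K) w v m) g ?_
  refine MvPolynomial.funext fun y => ?_
  have hminor (i : Fin d → Fin n) : MvPolynomial.eval y (minor (genericColumns K w v) i) =
      minor (fun c r => MvPolynomial.eval y (genericColumns K w v c r)) i := by
    rw [minor, RingHom.map_det]
    rfl
  simp only [map_sum, MvPolynomial.smul_eval, map_prod, hminor, map_zero]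
  -- Independent columns give a point of X_w^v; dependent ones make every minor vanish, and `hm`
  -- provides a factor.
  by_cases ha : LinearIndependent K fun c r => MvPolynomial.eval y (genericColumns K w v c r)
  · have h := eval_eq_zero_of_mem_vanishingIdeal hmem (span_mem_richardsonVariety ha
      fun c r hcr => by rw [genericColumns, if_neg hcr, map_zero]) (Basis.span ha)
    simpa [Basis.span_apply] using h
  · refine Finset.sum_eq_zero fun τ _ => ?_
    rw [Finset.prod_eq_zero (Finset.mem_univ ⟨0, hm⟩)
      (minor_eq_zero_of_not_linearIndependent ha (τ.1 _).1), mul_zero]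

end Independence

end Richardson

end

theorem mainTheorem1 (K : Type*) [Field K] [IsAlgClosed K] (d n : ℕ) (hd : 1 ≤ d) (hdn : d < n)
    (w v : Richardson.Index d n) (hX : (Richardson.richardsonVariety K w v).Nonempty) (m : ℕ) :
    -- the standard monomials of degree `m` on `X_w^v` are linearly independent in `R_w^v`
    LinearIndependent K
      (fun τ : {τ : Fin m → Richardson.Index d n // Richardson.IsStandardOn w v τ} =>
        Richardson.monomial (Richardson.richardsonVariety K w v) τ.1) ∧
    -- every monomial of degree `m` is a combination of standard ones in the ring of `G_{d,n}`
    (∀ σ : Fin m → Richardson.Index d n,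
      Richardson.monomial (Set.univ : Set (Richardson.Grassmannian K d n)) σ ∈
        Submodule.span K {f | ∃ τ : Fin m → Richardson.Index d n,
          Richardson.IsStandard τ ∧ f = Richardson.monomial Set.univ τ}) ∧
    -- the standard monomials on `X_w^v` of degree `m` form a basis of the degree `m` part
    (∃ b : Module.Basis {τ : Fin m → Richardson.Index d n // Richardson.IsStandardOn w v τ} K
        (Richardson.degreePart (Richardson.richardsonVariety K w v) m),
      ∀ τ, (b τ : Richardson.CoordinateRing (Richardson.richardsonVariety K w v)) =
        Richardson.monomial (Richardson.richardsonVariety K w v) τ.1) := by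
  have : Infinite K := inferInstance
  have hli := Richardson.linearIndependent_monomial w v hX m
  refine ⟨hli, Richardson.monomial_mem_span_isStandard, ?_⟩
  have hspan : Submodule.span K (Set.range
      fun τ : {τ : Fin m → Richardson.Index d n // Richardson.IsStandardOn w v τ} =>
        Richardson.monomial (Richardson.richardsonVariety K w v) τ.1) =
      Richardson.degreePart (Richardson.richardsonVariety K w v) m := by
    rw [Richardson.degreePart_eq_span]
    refine le_antisymm (Submodule.span_mono ?_) (Submodule.span_le.2 ?_)
    · rintro _ ⟨τ, rfl⟩
      exact ⟨τ.1, rfl⟩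
    · rintro _ ⟨σ, rfl⟩
      exact Richardson.monomial_mem_span_isStandardOn w v σ
  refine ⟨(Module.Basis.span hli).map (LinearEquiv.ofEq _ _ hspan), fun τ => ?_⟩
  rw [Module.Basis.map_apply, LinearEquiv.coe_ofEq_apply, Module.Basis.span_apply]
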